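/- Let $\mu\subseteq\lambda$ be integer partitions (padded with zeros). The boxes of the skew shape $\lambda/\mu$ are the pairs $(i,j)$ with $\mu_i<j\le\lambda_i$, and $P_{\lambda/\mu}$ is the poset on these boxes whose covering relations are that $(i,j)$ covers $(i+1,j)$ and $(i,j+1)$ (whenever both boxes lie in $\lambda/\mu$). The order polynomial $\Omega(P;t)\in\mathbb{Q}[t]$ of a finite poset $P$ is the unique polynomial whose value at each positive integer $t$ is the number of order preserving maps $P\to\{1<\dots<t\}$. Let $c_1(P_{\lambda/\mu})$ be the coefficient of $t$ in $\Omega(P_{\lambda/\mu};t)$. Call $\lambda/\mu$ connected if it is nonempty and the Hasse diagram of $P_{\lambda/\mu}$ is a connected graph, that is, any two boxes are joined by a path of boxes of $\lambda/\mu$ in which consecutive boxes share an edge. (a) If $\lambda/\mu$ is not connected, then $c_1(P_{\lambda/\mu})=0$. (b) If $\lambda/\mu$ is connected, then $c_1(P_{\lambda/\mu})>0$. (c) Suppose that $\lambda/\mu$ is nonempty, let $r$ and $s$ be the indices of its first and its last nonempty row, and let $\ell=s-r+1$ be its length. Then $\lambda/\mu$ is not connected if and only if $\lambda_i=\mu_i$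 for some $r\le i\le s$ or $\lambda_i\le\mu_{i-1}$ for some $r<i\le s$. If $\lambda/\mu$ is connected, then \[c_1(P_{\lambda/\mu})=\frac{(\lambda_r-\mu_s-1)!\,(\ell-1)!}{(\lambda_r-\mu_s-1+\ell)!}.\] In particular, when the nonempty first and last rows are rows $1$ and $\ell$, this is $\dfrac{(\lambda_1-\mu_\ell-1)!\,(\ell-1)!}{(\lambda_1-\mu_\ell-1+\ell)!}$. -/

import Mathlib

open Polynomial

/-- The number of order preserving maps `X → {1 < ⋯ < t}` with image exactly `s` depends only on the
size of `s`. -/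
theorem card_orderHom_image_eq (X : Type*) [PartialOrder X] [Fintype X] (t : ℕ)
    (s : Finset (Fin t)) :
    Nat.card {f : X →o Fin t // Set.range f = (s : Set (Fin t))} =
      Nat.card {f : X →o Fin s.card // Function.Surjective f} := by
  let e : Fin s.card ≃o s := s.orderIsoOfFin rfl
  refine Nat.card_congr
    { toFun := fun f => ⟨⟨fun x => e.symm ⟨f.1 x, ?_⟩, ?_⟩, ?_⟩
      invFun := fun g => ⟨⟨fun x => (e (g.1 x) : Fin t), ?_⟩, ?_⟩
      left_inv := ?_
      right_inv := ?_ }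
  · have h : f.1 x ∈ Set.range f.1 := ⟨x, rfl⟩
    rw [f.2] at h
    exact h
  · intro x y hxy
    exact e.symm.monotone (f.1.monotone hxy)
  · intro k
    have h : (e k : Fin t) ∈ Set.range f.1 := by
      rw [f.2]
      exact (e k).2
    obtain ⟨x, hx⟩ := h
    refine ⟨x, ?_⟩
    change e.symm _ = k
    rw [OrderIso.symm_apply_eq]
    exact Subtype.ext hx
  · intro x y hxy
    exact e.monotone (g.1.monotone hxy)
  · ext y
    constructor
    · rintro ⟨x, rfl⟩
      exact (e (g.1 x)).2
    · intro hy
      obtain ⟨x, hx⟩ := g.2 (e.symm ⟨y, hy⟩)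
      refine ⟨x, ?_⟩
      change (e (g.1 x) : Fin t) = y
      rw [hx, OrderIso.apply_symm_apply]
  · intro f
    ext x
    change ((e (e.symm _) : Fin t) : ℕ) = _
    rw [OrderIso.apply_symm_apply]
  · intro g
    ext x
    change ((e.symm (e (g.1 x)) : Fin s.card) : ℕ) = _
    rw [OrderIso.symm_apply_apply]

/-- The counting function of order preserving maps into chains is a polynomial. -/
theorem exists_orderPolynomial (X : Type*) [PartialOrder X] [Finite X] :
    ∃ p : ℚ[X], ∀ t : ℕ, p.eval (t : ℚ) = Nat.card (X →o Fin t) := by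
  classical
  have := Fintype.ofFinite X
  set g : ℕ → ℕ := fun k => Nat.card {f : X →o Fin k // Function.Surjective f} with hg
  have hg0 : ∀ k, Fintype.card X < k → g k = 0 := by
    intro k hk
    have : IsEmpty {f : X →o Fin k // Function.Surjective f} := by
      constructor
      rintro ⟨f, hf⟩
      have := Fintype.card_le_of_surjective f hf
      simp at this
      omega
    exact Nat.card_of_isEmpty
  refine ⟨∑ k ∈ Finset.range (Fintype.card X + 1),
    C ((g k : ℚ) / (k.factorial : ℚ)) * descPochhammer ℚ k, fun t => ?_⟩
  have fin : Finite (X →o Fin t) := DFunLike.finite _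
  have h1 : Nat.card (X →o Fin t) =
      ∑ s ∈ (Finset.univ : Finset (Fin t)).powerset, g s.card := by
    have e : (X →o Fin t) ≃ Σ s : Finset (Fin t),
        {f : X →o Fin t // Set.range f = (s : Set (Fin t))} :=
      { toFun := fun f => ⟨Finset.univ.image f, f, by simp⟩
        invFun := fun p => p.2.1
        left_inv := fun f => rfl
        right_inv := by
          rintro ⟨s, f, hf⟩
          have : Finset.univ.image f = s := by
            apply Finset.coe_injective
            rw [← hf]; simp
          subst this
          rfl }
    rw [Nat.card_congr e, Nat.card_sigma, Finset.powerset_univ]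
    exact Finset.sum_congr rfl fun s _ => card_orderHom_image_eq X t s
  have h2 : Nat.card (X →o Fin t) = ∑ k ∈ Finset.range (Fintype.card X + 1), t.choose k * g k := by
    rw [h1, Finset.sum_powerset_apply_card (fun k => g k)]
    simp only [Finset.card_univ, Fintype.card_fin, smul_eq_mul]
    rw [← Finset.sum_subset (s₁ := Finset.range (min t (Fintype.card X) + 1))
        (s₂ := Finset.range (t + 1)),
      ← Finset.sum_subset (s₁ := Finset.range (min t (Fintype.card X) + 1))
        (s₂ := Finset.range (Fintype.card X + 1))]
    · intro k; simp only [Finset.mem_range]; omega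
    · intro k hk hk'
      simp only [Finset.mem_range] at hk hk'
      rw [Nat.choose_eq_zero_of_lt (by omega), zero_mul]
    · intro k; simp only [Finset.mem_range]; omega
    · intro k hk hk'
      simp only [Finset.mem_range] at hk hk'
      rw [hg0 k (by omega), mul_zero]
  rw [h2, eval_finsetSum]
  push_cast
  refine Finset.sum_congr rfl fun k _ => ?_
  rw [eval_mul, eval_C, descPochhammer_eval_eq_descFactorial,
    Nat.descFactorial_eq_factorial_mul_choose]
  have : (k.factorial : ℚ) ≠ 0 := by positivity
  push_cast
  field_simp

/-- There is exactly one polynomial which for each positive integer `t` counts the order preserving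
maps from `X` to the chain with `t` elements. -/
theorem existsUnique_orderPolynomial (X : Type*) [PartialOrder X] [Finite X] :
    ∃! p : ℚ[X], ∀ t : ℕ, 0 < t → p.eval (t : ℚ) = Nat.card (X →o Fin t) := by
  obtain ⟨p, hp⟩ := exists_orderPolynomial X
  refine ⟨p, fun t _ => hp t, fun q hq => ?_⟩
  refine Polynomial.eq_of_infinite_eval_eq q p ?_
  refine Set.Infinite.mono (s := Set.range fun n : ℕ => ((n + 1 : ℕ) : ℚ)) ?_ ?_
  · rintro _ ⟨n, rfl⟩
    change q.eval _ = p.eval _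
    rw [hq _ n.succ_pos, hp]
  · refine Set.infinite_range_of_injective fun a b hab => ?_
    simpa using hab

/-- The order polynomial `Ω(X; t) ∈ ℚ[t]` of a finite poset `X`: the unique polynomial such that
`Ω(X; t)` is the number of order preserving maps `X → {1 < ⋯ < t}` for each positive integer `t`. -/
noncomputable def orderPolynomial (X : Type*) [PartialOrder X] [Finite X] : ℚ[X] :=
  (existsUnique_orderPolynomial X).choose

theorem orderPolynomial_spec (X : Type*) [PartialOrder X] [Finite X] (t : ℕ) (ht : 0 < t) :
    (orderPolynomial X).eval (t : ℚ) = Nat.card (X →o Fin t) :=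
  (existsUnique_orderPolynomial X).choose_spec.1 t ht

/-- The boxes of the skew shape `lam / mu`. Rows and columns are numbered from `0`, so the box
`(i, j)` belongs to it if and only if `mu.rowLen i ≤ j < lam.rowLen i`. -/
@[ext]
structure SkewCells (lam mu : YoungDiagram) where
  box : ℕ × ℕ
  mem : box ∈ lam
  notMem : box ∉ mu

instance SkewCells.instFinite (lam mu : YoungDiagram) : Finite (SkewCells lam mu) :=
  Finite.of_injective (fun c : SkewCells lam mu => (⟨c.box, c.mem⟩ : lam.cells))
    fun _ _ h => SkewCells.ext (congrArg Subtype.val h)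

/-- The cell poset of `lam / mu`: a box is below another one if it is weakly below and weakly to the
right of it in the diagram. Its covering relations are described by `SkewCells.covBy_iff`. -/
instance SkewCells.instPartialOrder (lam mu : YoungDiagram) : PartialOrder (SkewCells lam mu) where
  le c d := d.box ≤ c.box
  le_refl c := le_refl c.box
  le_trans _ _ _ h h' := le_trans h' h
  le_antisymm _ _ h h' := SkewCells.ext (le_antisymm h' h)

theorem SkewCells.lt_iff {lam mu : YoungDiagram} (c d : SkewCells lam mu) :
    c < d ↔ d.box < c.box := by
  rw [lt_iff_le_not_ge, lt_iff_le_not_ge]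
  rfl

/-- The covering relations of the cell poset: `(i, j)` covers `(i + 1, j)` and `(i, j + 1)`. -/
theorem SkewCells.covBy_iff {lam mu : YoungDiagram} (c d : SkewCells lam mu) :
    c ⋖ d ↔ c.box = (d.box.1 + 1, d.box.2) ∨ c.box = (d.box.1, d.box.2 + 1) := by
  obtain ⟨⟨i, j⟩, hc, hc'⟩ := c
  obtain ⟨⟨a, b⟩, hd, hd'⟩ := d
  constructor
  · rintro ⟨hlt, hmin⟩
    rw [SkewCells.lt_iff] at hlt
    have hmem : ∀ x y : ℕ, a ≤ x → b ≤ y → x ≤ i → y ≤ j → (x, y) ∈ lam ∧ (x, y) ∉ mu :=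
      fun x y h1 h2 h3 h4 => ⟨lam.up_left_mem h3 h4 hc, fun h => hd' (mu.up_left_mem h1 h2 h)⟩
    simp only [SkewCells.lt_iff, Prod.lt_iff] at hlt hmin
    simp only [Prod.mk.injEq]
    by_cases hai : a < i
    · obtain ⟨h1, h2⟩ := hmem (a + 1) b (by omega) le_rfl (by omega) (by omega)
      have := @hmin ⟨(a + 1, b), h1, h2⟩
      simp only at this
      omega
    · obtain ⟨h1, h2⟩ := hmem a (b + 1) le_rfl (by omega) (by omega) (by omega)
      have := @hmin ⟨(a, b + 1), h1, h2⟩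
      simp only at this
      omega
  · intro h
    simp only [Prod.mk.injEq] at h
    constructor
    · rw [SkewCells.lt_iff, Prod.lt_iff]
      simp only
      omega
    · rintro ⟨⟨x, y⟩, hx, hx'⟩ h1 h2
      rw [SkewCells.lt_iff, Prod.lt_iff] at h1 h2
      simp only at h1 h2
      omega

/-- The skew shape `lam / mu` is connected if it is nonempty and any two of its boxes are joined by a
path of boxes of the shape in which consecutive boxes share an edge, that is to say, if the Hasse
diagram of its cell poset is a connected graph. -/
def SkewConnected (lam mu : YoungDiagram) : Prop :=
  (SimpleGraph.hasse (SkewCells lam mu)).Connected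

/-- The index set of the nonempty rows of the skew shape `lam / mu`. -/
def skewRows (lam mu : YoungDiagram) : Set ℕ :=
  {i | mu.rowLen i < lam.rowLen i}

/-! Write p for λ and v(c, q) for the row vector with entries h_{q+j-μ_j}(c-j), where h_b(τ) is the
coefficient of x^b in (1-x)^(-τ). A flagged Jacobi–Trudi formula gives Ω(t) as the determinant with
rows v(t+i, p_i-i). It is proved by removing boxes: a corner filled with the least value is deleted,
and on the matrix side this is Pascal's rule v(c, q) = v(c, q-1) + v(c-1, q) in one row
(`ncard_skewFillings`).

The coefficient of t is the derivative of the determinant at 0, hence a sum over rows r. Since d/dτ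
(1-x)^(-τ) = -log(1-x) (1-x)^(-τ), row r is replaced by the sum over m of v(r, p_r-(m+1)-r)/(m+1).
Repeated summation by parts through Pascal's rule turns the weights 1/(m+1) into Beta values B(m+1,
k+1), with boundary terms that vanish because two rows agree or one is zero
(`sum_betaFrac_zero_mul_det`).

The replaced row then has the bound of row r+k and a length between p_{r+k+1} and p_{r+k}. Moved
down to position r+k, which costs the sign (-1)^k that cancels the sign of the summation, it gives a
counting determinant with all row bounds 0 or 1, equal to 0 or 1. It is 1 exactly when rows r, …,
r+k form a connected shape with all other rows empty and m+1 = p_r-μ_{r+k}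
(`neg_one_pow_mul_det_updateRow`). So the sum is empty for a disconnected shape, and otherwise a
single Beta value. -/

/-! ### Rising binomial polynomials and their derivatives -/

/-- The coefficient of `x ^ b` in `(1 - x) ^ (-τ)`, as a polynomial in `τ`. -/
noncomputable def risingBinom : ℤ → ℚ[X]
  | Int.ofNat n => C ((n.factorial : ℚ)⁻¹) * ascPochhammer ℚ n
  | Int.negSucc _ => 0

theorem risingBinom_of_neg {b : ℤ} (hb : b < 0) : risingBinom b = 0 := by
  cases b with
  | ofNat n => exact absurd hb (by simp)
  | negSucc n => rfl

theorem risingBinom_natCast (n : ℕ) :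
    risingBinom n = C ((n.factorial : ℚ)⁻¹) * ascPochhammer ℚ n := rfl

theorem eval_risingBinom_pascal (b : ℤ) (τ : ℚ) :
    (risingBinom b).eval τ = (risingBinom (b - 1)).eval τ + (risingBinom b).eval (τ - 1) := by
  rcases lt_trichotomy b 0 with hb | rfl | hb
  · simp [risingBinom_of_neg hb, risingBinom_of_neg (show b - 1 < 0 by omega)]
  · rw [risingBinom_of_neg (show (0 : ℤ) - 1 < 0 by omega), ← Nat.cast_zero, risingBinom_natCast]
    simp
  · obtain ⟨n, rfl⟩ : ∃ n : ℕ, b = ((n + 1 : ℕ) : ℤ) := ⟨(b - 1).toNat, by omega⟩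
    rw [show ((n + 1 : ℕ) : ℤ) - 1 = (n : ℤ) by push_cast; ring, risingBinom_natCast,
      risingBinom_natCast, eval_mul, eval_mul, eval_mul, eval_C, eval_C, eval_C]
    have h1 : (ascPochhammer ℚ (n + 1)).eval τ = (ascPochhammer ℚ n).eval τ * (τ + n) :=
      ascPochhammer_succ_eval n τ
    have h2 : (ascPochhammer ℚ (n + 1)).eval (τ - 1) = (τ - 1) * (ascPochhammer ℚ n).eval τ := by
      rw [ascPochhammer_succ_left]
      simp [eval_comp]
    rw [h1, h2, Nat.factorial_succ]
    have h3 : (n.factorial : ℚ) ≠ 0 := by positivity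
    have h4 : (n + 1 : ℚ) ≠ 0 := by positivity
    push_cast
    field_simp
    ring

theorem risingBinom_zero : risingBinom 0 = 1 := by
  rw [← Nat.cast_zero, risingBinom_natCast]
  simp

theorem eval_risingBinom_neg (n : ℕ) {b : ℤ} (hb : (n : ℤ) < b) :
    (risingBinom b).eval (-(n : ℚ)) = 0 := by
  obtain ⟨m, rfl⟩ : ∃ m : ℕ, b = (m : ℤ) := ⟨b.toNat, by omega⟩
  have h : (ascPochhammer ℚ m).eval (-(n : ℚ)) = 0 := by
    rw [ascPochhammer_eval_eq_zero_iff]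
    exact ⟨n, by omega, by simp⟩
  rw [risingBinom_natCast, eval_mul, h, mul_zero]

theorem eval_risingBinom_one {b : ℤ} (hb : 0 ≤ b) : (risingBinom b).eval 1 = 1 := by
  obtain ⟨m, rfl⟩ : ∃ m : ℕ, b = (m : ℤ) := ⟨b.toNat, by omega⟩
  have h3 : (m.factorial : ℚ) ≠ 0 := by positivity
  rw [risingBinom_natCast, eval_mul, eval_C, ascPochhammer_eval_one]
  field_simp

/-- A polynomial of period 1 is constant. This reduces identities to a common difference equation
and one value. -/
theorem eq_zero_of_eval_sub_one {d : ℚ[X]} (h : ∀ τ, d.eval τ = d.eval (τ - 1))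
    (h0 : d.eval 0 = 0) : d = 0 := by
  have h1 : ∀ n : ℕ, d.eval (n : ℚ) = 0 := by
    intro n
    induction n with
    | zero => simpa using h0
    | succ n ih => rw [h]; push_cast; simpa using ih
  refine Polynomial.eq_zero_of_infinite_isRoot d
    (Set.Infinite.mono (s := Set.range fun n : ℕ => (n : ℚ)) ?_
      (Set.infinite_range_of_injective Nat.cast_injective))
  rintro _ ⟨n, rfl⟩
  exact h1 n

/-- Coefficientwise form of d/dτ (1-x)^(-τ) = -log(1-x) (1-x)^(-τ). By Pascal's rule and induction
on n both sides have the same difference between τ and τ-1, and at τ = 0 only the term m = n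
survives on the right. -/
theorem derivative_risingBinom_natCast (n : ℕ) : derivative (risingBinom n) =
    ∑ m ∈ Finset.range n, C ((m + 1 : ℚ)⁻¹) * risingBinom ((n : ℤ) - 1 - m) := by
  induction n with
  | zero => rw [Nat.cast_zero, risingBinom_zero]; simp
  | succ n ih =>
    rw [← sub_eq_zero]
    have hcast : ∀ m : ℕ, ((n + 1 : ℕ) : ℤ) - 1 - m = n - m := fun m => by push_cast; ring
    apply eq_zero_of_eval_sub_one
    · intro τ
      have hd : (derivative (risingBinom (n + 1 : ℕ))).eval τ =
          (derivative (risingBinom n)).eval τ +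
            (derivative (risingBinom (n + 1 : ℕ))).eval (τ - 1) := by
        have hp : risingBinom (n + 1 : ℕ) = risingBinom n + (risingBinom (n + 1 : ℕ)).comp (X - 1) := by
          apply Polynomial.funext
          intro x
          rw [eval_risingBinom_pascal, eval_add, eval_comp]
          simp
        conv_lhs => rw [hp]
        rw [derivative_add, derivative_comp, eval_add, eval_mul, eval_comp]
        simp
      have hs : (∑ m ∈ Finset.range (n + 1),
            C ((m + 1 : ℚ)⁻¹) * risingBinom (((n + 1 : ℕ) : ℤ) - 1 - m)).eval τ =
          (∑ m ∈ Finset.range n, C ((m + 1 : ℚ)⁻¹) * risingBinom ((n : ℤ) - 1 - m)).eval τ +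
          (∑ m ∈ Finset.range (n + 1),
            C ((m + 1 : ℚ)⁻¹) * risingBinom (((n + 1 : ℕ) : ℤ) - 1 - m)).eval (τ - 1) := by
        have hz : ∑ m ∈ Finset.range n, C ((m + 1 : ℚ)⁻¹) * risingBinom ((n : ℤ) - 1 - m) =
            ∑ m ∈ Finset.range (n + 1), C ((m + 1 : ℚ)⁻¹) * risingBinom ((n : ℤ) - 1 - m) := by
          rw [Finset.sum_range_succ, risingBinom_of_neg (show (n : ℤ) - 1 - n < 0 by omega)]
          simp
        rw [hz]
        simp only [eval_finsetSum, eval_mul, eval_C]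
        rw [← Finset.sum_add_distrib]
        refine Finset.sum_congr rfl fun m _ => ?_
        rw [hcast, eval_risingBinom_pascal, ← mul_add,
          show (n : ℤ) - m - 1 = n - 1 - m by ring]
      rw [eval_sub, eval_sub, hd, hs, ih]
      ring
    · have h3 : (n.factorial : ℚ) ≠ 0 := by positivity
      have h4 : (n + 1 : ℚ) ≠ 0 := by positivity
      have hd : (derivative (risingBinom (n + 1 : ℕ))).eval 0 = (n + 1 : ℚ)⁻¹ := by
        rw [risingBinom_natCast, ascPochhammer_succ_left]
        simp [derivative_mul, eval_comp, ascPochhammer_eval_one, Nat.factorial_succ]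
        field_simp
      rw [eval_sub, hd, eval_finsetSum, Finset.sum_range_succ, Finset.sum_eq_zero]
      · rw [hcast, sub_self, risingBinom_zero]
        simp
      · intro m hm
        have := eval_risingBinom_neg 0 (b := ((n + 1 : ℕ) : ℤ) - 1 - m)
          (by simp at hm; push_cast; omega)
        rw [Nat.cast_zero, neg_zero] at this
        rw [eval_mul, this, mul_zero]

theorem derivative_risingBinom {b : ℤ} {N : ℕ} (hN : b ≤ N) : derivative (risingBinom b) =
    ∑ m ∈ Finset.range N, C ((m + 1 : ℚ)⁻¹) * risingBinom (b - 1 - m) := by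
  rcases lt_or_ge b 0 with hb | hb
  · rw [risingBinom_of_neg hb, Finset.sum_eq_zero]
    · simp
    · intro m _
      rw [risingBinom_of_neg (by omega), mul_zero]
  · obtain ⟨n, rfl⟩ : ∃ n : ℕ, b = (n : ℤ) := ⟨b.toNat, by omega⟩
    rw [derivative_risingBinom_natCast]
    refine Finset.sum_subset (fun m => by simp; omega) fun m _ hm => ?_
    rw [risingBinom_of_neg (by simp at hm; omega), mul_zero]

/-! ### Determinants forced to be 0 or 1 -/

section ZeroPatterns

variable {L : ℕ}

/-- Pigeonhole: when the block sides add up to more than L, every permutation meets the block. -/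
theorem Matrix.det_eq_zero_of_zero_block (M : Matrix (Fin L) (Fin L) ℚ) (A B : Finset (Fin L))
    (hAB : L < A.card + B.card) (h : ∀ i ∈ A, ∀ j ∈ B, M i j = 0) : M.det = 0 := by
  rw [Matrix.det_apply]
  refine Finset.sum_eq_zero fun σ _ => ?_
  obtain ⟨j, hjB, hjA⟩ : ∃ j ∈ B, σ j ∈ A := by
    by_contra! hcon
    have hd : Disjoint A (B.map σ.toEmbedding) := by
      rw [Finset.disjoint_right]
      intro x hx
      obtain ⟨j, hj, rfl⟩ := Finset.mem_map.1 hx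
      exact hcon j hj
    have := Finset.card_le_univ (A ∪ B.map σ.toEmbedding)
    rw [Finset.card_union_of_disjoint hd, Finset.card_map, Fintype.card_fin] at this
    omega
  have hprod : ∏ i, M (σ i) i = 0 := Finset.prod_eq_zero (Finset.mem_univ j) (h _ hjA _ hjB)
  exact (congrArg _ hprod).trans (smul_zero _)

theorem Equiv.Perm.eq_one_of_forall_le (σ : Equiv.Perm (Fin L)) (h : ∀ i, σ i ≤ i) : σ = 1 := by
  ext1 i
  induction i using WellFoundedLT.induction with
  | ind i ih =>
    rcases (h i).lt_or_eq with hlt | heq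
    · exact σ.injective (ih _ hlt)
    · exact heq

/-- A row vector of the determinant counting reverse plane partitions. -/
noncomputable def skewRowVec (L : ℕ) (μ : ℕ → ℤ) (c q : ℤ) : Fin L → ℚ :=
  fun j => (risingBinom (q + (j : ℕ) - μ j)).eval ((c - (j : ℕ) : ℤ) : ℚ)

theorem skewRowVec_pascal (μ : ℕ → ℤ) (c q : ℤ) :
    skewRowVec L μ c q = skewRowVec L μ c (q - 1) + skewRowVec L μ (c - 1) q := by
  ext j
  simp only [skewRowVec, Pi.add_apply]
  rw [eval_risingBinom_pascal]
  congr 2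
  · congr 1; ring
  · push_cast; ring

theorem skewRowVec_apply_eq_zero {μ : ℕ → ℤ} {c q : ℤ} {j : Fin L} (h : q + (j : ℕ) < μ j) :
    skewRowVec L μ c q j = 0 := by
  rw [skewRowVec, risingBinom_of_neg (by omega), eval_zero]

theorem skewRowVec_apply_eq_zero' {μ : ℕ → ℤ} {c q : ℤ} {j : Fin L} (h : c ≤ j)
    (h' : μ j < q + c) : skewRowVec L μ c q j = 0 := by
  obtain ⟨n, hn⟩ : ∃ n : ℕ, c = j - n := ⟨(j - c).toNat, by omega⟩
  rw [skewRowVec, hn, show ((((j : ℕ) : ℤ) - n - ((j : ℕ) : ℤ) : ℤ) : ℚ) = -(n : ℚ) by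
    push_cast; ring]
  exact eval_risingBinom_neg n (by omega)

/-- The matrix whose determinant counts the reverse plane partitions of shape `p / μ` with row
bounds given by `c`. -/
noncomputable def skewMatrix (L : ℕ) (μ c p : ℕ → ℤ) : Matrix (Fin L) (Fin L) ℚ :=
  Matrix.of fun i => skewRowVec L μ (c i + (i : ℕ)) (p i - (i : ℕ))

theorem det_skewMatrix_eq_zero_of_lt {μ c p : ℕ → ℤ} (hμ : Antitone μ) {k : ℕ} (hk : k < L)
    (h : ∀ i, k ≤ i → i < L → p i < μ k) : (skewMatrix L μ c p).det = 0 := by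
  refine Matrix.det_eq_zero_of_zero_block _ (Finset.Ici ⟨k, hk⟩) (Finset.Iic ⟨k, hk⟩)
    (by rw [Fin.card_Ici, Fin.card_Iic]; simp; omega) fun i hi j hj => ?_
  have hi' : k ≤ i := by simpa [Fin.le_def] using hi
  have hj' : (j : ℕ) ≤ k := by simpa [Fin.le_def] using hj
  have := hμ hj'
  have := h i hi' i.2
  exact skewRowVec_apply_eq_zero (by omega)

/-- In the block of rows up to k and columns from k on, the entries evaluate h_b at -n with 0 ≤ n <
b, where it vanishes. The block sides add up to L+1. -/
theorem det_skewMatrix_eq_zero_of_gt {μ c p : ℕ → ℤ} (hμ : Antitone μ)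
    (hc : ∀ i, c i = 0 ∨ c i = 1) {k : ℕ} (hk : k < L) (hck : c k = 0)
    (h : ∀ i, i ≤ k → μ k < p i) : (skewMatrix L μ c p).det = 0 := by
  refine Matrix.det_eq_zero_of_zero_block _ (Finset.Iic ⟨k, hk⟩) (Finset.Ici ⟨k, hk⟩)
    (by rw [Fin.card_Ici, Fin.card_Iic]; simp; omega) fun i hi j hj => ?_
  have hi' : (i : ℕ) ≤ k := by simpa [Fin.le_def] using hi
  have hj' : k ≤ (j : ℕ) := by simpa [Fin.le_def] using hj
  have := hμ hj'
  have := h i hi'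
  have := hc i
  have hci : (i : ℕ) = k → c i = 0 := fun h => by rw [h, hck]
  exact skewRowVec_apply_eq_zero' (by omega) (by omega)

/-- Only the identity contributes to the Leibniz expansion: a permutation with i < σ i for some i
meets a zero entry, in row i if the bound there is 1, and in a later row if it is 0. -/
theorem det_skewMatrix_eq_one {μ c p : ℕ → ℤ} (hμ : Antitone μ)
    (hp : ∀ i j, i ≤ j → j < L → p j ≤ p i)
    (hc : ∀ i, i < L → (c i = 0 ∧ p i = μ i) ∨ (c i = 1 ∧ μ i ≤ p i)) :
    (skewMatrix L μ c p).det = 1 := by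
  rw [← Matrix.det_transpose, Matrix.det_apply, Finset.sum_eq_single 1]
  · rw [Finset.prod_eq_one]
    · simp
    · intro i _
      simp only [Equiv.Perm.coe_one, id_eq, Matrix.transpose_apply, skewMatrix, skewRowVec,
        Matrix.of_apply]
      rcases hc i i.2 with ⟨h1, h2⟩ | ⟨h1, h2⟩
      · rw [h1, h2, show μ i - (i : ℕ) + (i : ℕ) - μ i = 0 by ring, risingBinom_zero, eval_one]
      · rw [h1, show (1 + ((i : ℕ) : ℤ) - ((i : ℕ) : ℤ)) = 1 by ring, Int.cast_one]
        exact eval_risingBinom_one (by omega)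
  · intro σ _ hσ
    by_cases hprod : ∏ i, (skewMatrix L μ c p).transpose (σ i) i = 0
    · rw [hprod, smul_zero]
    replace hprod := Finset.prod_ne_zero_iff.1 hprod
    refine absurd (Equiv.Perm.eq_one_of_forall_le σ fun i => ?_) hσ
    by_contra! hlt
    have hlt' : (i : ℕ) < σ i := hlt
    have hne : skewRowVec L μ (c i + (i : ℕ)) (p i - (i : ℕ)) (σ i) ≠ 0 :=
      hprod i (Finset.mem_univ i)
    have hμi := hμ hlt'.le
    rcases hc i i.2 with ⟨h1, h2⟩ | ⟨h1, h2⟩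
    -- If σ sent every k > i above i, then, as σ i > i too, it would inject {i, …} into {i+1, …}.
    · obtain ⟨k, hk, hk'⟩ : ∃ k, i < k ∧ σ k ≤ i := by
        by_contra! hcon
        have hsub : (Finset.Ici i).map σ.toEmbedding ⊆ Finset.Ioi i := by
          intro x hx
          obtain ⟨k, hk, rfl⟩ := Finset.mem_map.1 hx
          rw [Finset.mem_Ici] at hk
          rw [Finset.mem_Ioi]
          rcases hk.eq_or_lt with rfl | hk
          · exact hlt
          · exact hcon k hk
        have := Finset.card_le_card hsub
        rw [Finset.card_map, Fin.card_Ici, Fin.card_Ioi] at this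
        have := i.2
        omega
      have hk1 : (i : ℕ) < k := hk
      have hk2 : (σ k : ℕ) ≤ i := hk'
      have := hμ hk2
      have := hp i k hk1.le k.2
      exact hprod k (Finset.mem_univ k) (skewRowVec_apply_eq_zero (by omega))
    · exact hne (skewRowVec_apply_eq_zero' (by omega) (by omega))
  · simp

end ZeroPatterns

/-! ### Counting fillings by a flagged determinant -/

/-- The box `x` belongs to the skew shape with row bounds `μ` and `p`. -/
def InSkewShape (μ p : ℕ → ℤ) (x : ℕ × ℕ) : Prop :=
  μ x.1 ≤ x.2 ∧ (x.2 : ℤ) < p x.1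

/-- Order preserving fillings of a skew shape by `0, …, t` in which the rows from `k` on avoid `0`,
extended by `0`. -/
def skewFillings (μ p : ℕ → ℤ) (t k : ℕ) : Set (ℕ × ℕ → ℕ) :=
  {f | (∀ x, ¬ InSkewShape μ p x → f x = 0) ∧ (∀ x, InSkewShape μ p x → f x ≤ t) ∧
    (∀ x, InSkewShape μ p x → k ≤ x.1 → 1 ≤ f x) ∧
    ∀ x y, InSkewShape μ p x → InSkewShape μ p y → x ≤ y → f y ≤ f x}

/-- Row bounds: `t + 1` values for the rows before `k`, `t` values from there on. -/
def rowFlag (t k : ℕ) (i : ℕ) : ℤ := if i < k then t + 1 else t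

theorem finite_inSkewShape {μ p : ℕ → ℤ} {L : ℕ} (hp : Antitone p) (hL : ∀ i, L ≤ i → p i = μ i) :
    {x | InSkewShape μ p x}.Finite := by
  refine (Finset.finite_toSet (Finset.range L ×ˢ Finset.range (p 0).toNat)).subset ?_
  rintro ⟨i, j⟩ ⟨h1, h2⟩
  simp only [Finset.coe_product, Finset.coe_range, Set.mem_prod, Set.mem_Iio] at *
  have := hp (Nat.zero_le i)
  refine ⟨?_, by omega⟩
  by_contra hi
  have := hL i (by omega)
  omega

theorem finite_skewFillings {μ p : ℕ → ℤ} {L : ℕ} (hp : Antitone p)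
    (hL : ∀ i, L ≤ i → p i = μ i) (t k : ℕ) : (skewFillings μ p t k).Finite := by
  have : Finite {x | InSkewShape μ p x} := finite_inSkewShape hp hL
  rw [← Set.finite_coe_iff]
  refine Finite.of_injective (β := {x | InSkewShape μ p x} → Fin (t + 1))
    (fun f x => ⟨f.1 x.1, Nat.lt_succ_of_le (f.2.2.1 x.1 x.2)⟩) fun f g h => ?_
  ext x
  by_cases hx : InSkewShape μ p x
  · simpa using congrFun h ⟨x, hx⟩
  · rw [f.2.1 x hx, g.2.1 x hx]

/-- Pascal's rule in row k and linearity of the determinant in that row. This mirrors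
`ncard_skewFillings_succ`. -/
theorem det_skewMatrix_rowFlag_succ {L : ℕ} (μ p : ℕ → ℤ) (t : ℕ) {k : ℕ} (hk : k < L) :
    (skewMatrix L μ (rowFlag t (k + 1)) p).det = (skewMatrix L μ (rowFlag t k) p).det +
      (skewMatrix L μ (rowFlag t (k + 1)) (Function.update p k (p k - 1))).det := by
  have h1 : skewMatrix L μ (rowFlag t (k + 1)) p =
      (skewMatrix L μ (rowFlag t (k + 1)) p).updateRow ⟨k, hk⟩
        (skewRowVec L μ (t + k) (p k - k) + skewRowVec L μ (t + 1 + k) (p k - k - 1)) := by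
    conv_lhs => rw [← Matrix.updateRow_eq_self (skewMatrix L μ (rowFlag t (k + 1)) p) ⟨k, hk⟩]
    congr 1
    have : skewMatrix L μ (rowFlag t (k + 1)) p ⟨k, hk⟩ =
        skewRowVec L μ (t + 1 + k) (p k - k) := by
      ext j
      simp [skewMatrix, rowFlag]
    refine this.trans ?_
    rw [skewRowVec_pascal, add_comm, show (t : ℤ) + 1 + k - 1 = t + k by ring]
  have h2 : (skewMatrix L μ (rowFlag t (k + 1)) p).updateRow ⟨k, hk⟩
      (skewRowVec L μ (t + k) (p k - k)) = skewMatrix L μ (rowFlag t k) p := by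
    ext i j
    rw [Matrix.updateRow_apply]
    split_ifs with h
    · subst h
      simp [skewMatrix, rowFlag]
    · have h' : (i : ℕ) ≠ k := fun h' => h (Fin.ext h')
      have : (i : ℕ) ≤ k ↔ (i : ℕ) < k := by omega
      simp [skewMatrix, rowFlag, this]
  have h3 : (skewMatrix L μ (rowFlag t (k + 1)) p).updateRow ⟨k, hk⟩
      (skewRowVec L μ (t + 1 + k) (p k - k - 1)) =
        skewMatrix L μ (rowFlag t (k + 1)) (Function.update p k (p k - 1)) := by
    ext i j
    rw [Matrix.updateRow_apply]
    split_ifs with h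
    · subst h
      simp [skewMatrix, rowFlag, sub_right_comm]
    · have h' : (i : ℕ) ≠ k := fun h' => h (Fin.ext h')
      simp [skewMatrix, Function.update_of_ne h']
  rw [h1, Matrix.det_updateRow_add, h2, h3]

theorem skewFillings_succ_of_forall {μ p : ℕ → ℤ} {t k : ℕ}
    (h : ∀ f ∈ skewFillings μ p t (k + 1), ∀ x, InSkewShape μ p x → x.1 = k → 1 ≤ f x) :
    skewFillings μ p t (k + 1) = skewFillings μ p t k := by
  ext f
  constructor
  · intro hf
    refine ⟨hf.1, hf.2.1, fun x hx hkx => ?_, hf.2.2.2⟩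
    rcases hkx.eq_or_lt with he | hlt
    · exact h f hf x hx he.symm
    · exact hf.2.2.1 x hx hlt
  · rintro ⟨h1, h2, h3, h4⟩
    exact ⟨h1, h2, fun x hx hkx => h3 x hx (by omega), h4⟩

theorem antitone_update_sub_one {p : ℕ → ℤ} (hp : Antitone p) {k : ℕ} (h : p (k + 1) < p k) :
    Antitone (Function.update p k (p k - 1)) := by
  refine antitone_nat_of_succ_le fun i => ?_
  have hi : p (i + 1) ≤ p i := hp i.le_succ
  simp only [Function.update_apply]
  split_ifs with h1 h2 h2
  · omega
  · subst h1; omega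
  · subst h2; omega
  · exact hi

/-- Shortening row k by one makes it equal to row k+1 as a vector: bound and length, shifted by the
row index, agree. -/
theorem det_skewMatrix_update_eq_zero {L : ℕ} (μ p : ℕ → ℤ) (t : ℕ) {k : ℕ} (hk : k + 1 < L)
    (h : p (k + 1) = p k) :
    (skewMatrix L μ (rowFlag t (k + 1)) (Function.update p k (p k - 1))).det = 0 := by
  refine Matrix.det_zero_of_row_eq (i := ⟨k, by omega⟩) (j := ⟨k + 1, hk⟩) (by simp) ?_
  have h1 : (t : ℤ) + 1 + k = t + (k + 1) := by ring
  have h2 : p k - 1 - k = p k - (k + 1) := by ring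
  ext j
  simp [skewMatrix, rowFlag, h, h1, h2]

/-- The last box of row k is a corner and carries the smallest value of its row. Either this value
is positive, and so is the whole row, or it is 0 and the box can be deleted. -/
theorem ncard_skewFillings_succ {μ p : ℕ → ℤ} (hμ0 : ∀ i, 0 ≤ μ i) {L : ℕ}
    (hp : Antitone p)
    (hL : ∀ i, L ≤ i → p i = μ i) (t : ℕ) {k : ℕ} (h1 : μ k < p k) (h2 : p (k + 1) < p k) :
    (skewFillings μ p t (k + 1)).ncard = (skewFillings μ p t k).ncard +
      (skewFillings μ (Function.update p k (p k - 1)) t (k + 1)).ncard := by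
  have hμk := hμ0 k
  set q := Function.update p k (p k - 1) with hq
  set b : ℕ × ℕ := (k, (p k - 1).toNat) with hb
  have hb2 : ((p k - 1).toNat : ℤ) = p k - 1 := Int.toNat_of_nonneg (by omega)
  have hbp : InSkewShape μ p b := ⟨by simp only [hb]; omega, by simp only [hb]; omega⟩
  have hqp : ∀ x, InSkewShape μ q x ↔ InSkewShape μ p x ∧ x ≠ b := by
    rintro ⟨i, j⟩
    by_cases hi : i = k
    · subst hi
      simp only [InSkewShape, hq, hb, Function.update_self, ne_eq, Prod.mk.injEq, true_and]
      omega
    · simp [InSkewShape, hq, hb, hi]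
  have hmax : ∀ y, InSkewShape μ p y → b ≤ y → y = b := by
    rintro ⟨i, j⟩ ⟨hy1, hy2⟩ hle
    obtain ⟨hle1, hle2⟩ := Prod.le_def.1 hle
    simp only [hb] at *
    rcases hle1.eq_or_lt with he | hlt
    · subst he
      simp only [Prod.mk.injEq, true_and]
      omega
    · have := hp (show k + 1 ≤ i from hlt)
      omega
  have hdis : Disjoint (skewFillings μ p t k) (skewFillings μ q t (k + 1)) := by
    rw [Set.disjoint_left]
    intro f hf hf'
    have := hf.2.2.1 b hbp le_rfl
    have := hf'.1 b fun h => ((hqp b).1 h).2 rfl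
    omega
  have hqa : Antitone q := antitone_update_sub_one hp h2
  have hqL : ∀ i, L ≤ i → q i = μ i := by
    intro i hi
    have : i ≠ k := by
      rintro rfl
      have := hL i hi
      omega
    simp [hq, this, hL i hi]
  rw [← Set.ncard_union_eq hdis (finite_skewFillings hp hL t k) (finite_skewFillings hqa hqL t _)]
  congr 1
  ext f
  constructor
  · intro hf
    by_cases hfb : f b = 0
    · right
      refine ⟨fun x hx => ?_, fun x hx => hf.2.1 x ((hqp x).1 hx).1,
        fun x hx => hf.2.2.1 x ((hqp x).1 hx).1,
        fun x y hx hy => hf.2.2.2 x y ((hqp x).1 hx).1 ((hqp y).1 hy).1⟩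
      by_cases hxb : x = b
      · rw [hxb, hfb]
      · exact hf.1 x fun h => hx ((hqp x).2 ⟨h, hxb⟩)
    · left
      refine ⟨hf.1, hf.2.1, fun x hx hkx => ?_, hf.2.2.2⟩
      rcases hkx.eq_or_lt with he | hlt
      · have hxb : x ≤ b := by
          have := hx.2
          rw [← he] at this
          rw [Prod.le_def]
          simp only [hb]
          omega
        have := hf.2.2.2 x b hx hbp hxb
        omega
      · exact hf.2.2.1 x hx hlt
  · rintro (hf | hf)
    · exact ⟨hf.1, hf.2.1, fun x hx hkx => hf.2.2.1 x hx (by omega), hf.2.2.2⟩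
    · have hfb : f b = 0 := hf.1 b fun h => ((hqp b).1 h).2 rfl
      refine ⟨fun x hx => hf.1 x fun h => hx ((hqp x).1 h).1, fun x hx => ?_, fun x hx hkx => ?_,
        fun x y hx hy hxy => ?_⟩
      · by_cases hxb : x = b
        · rw [hxb, hfb]; omega
        · exact hf.2.1 x ((hqp x).2 ⟨hx, hxb⟩)
      · refine hf.2.2.1 x ((hqp x).2 ⟨hx, ?_⟩) hkx
        rintro rfl
        simp only [hb] at hkx
        omega
      · by_cases hyb : y = b
        · rw [hyb, hfb]; omega
        · have hxb : x ≠ b := by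
            rintro rfl
            exact hyb (hmax y hy hxy)
          exact hf.2.2.2 x y ((hqp x).2 ⟨hx, hxb⟩) ((hqp y).2 ⟨hy, hyb⟩) hxy

/-- Subtracting 1 from all values turns positive fillings bounded by t+1 into fillings bounded by t
in which 0 is allowed in every row. This links the end of the induction on k to the next t. -/
theorem ncard_skewFillings_shift {μ p : ℕ → ℤ} {L : ℕ} (hL : ∀ i, L ≤ i → p i = μ i) (t : ℕ) :
    (skewFillings μ p (t + 1) 0).ncard = (skewFillings μ p t L).ncard := by
  classical
  have hrow : ∀ x, InSkewShape μ p x → x.1 < L := by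
    intro x hx
    by_contra hcon
    have := hL x.1 (by omega)
    have := hx.1
    have := hx.2
    omega
  refine Set.ncard_congr (fun f _ x => f x - 1) ?_ ?_ ?_
  · intro f hf
    refine ⟨fun x hx => by simp [hf.1 x hx], fun x hx => ?_, fun x hx hLx => ?_,
      fun x y hx hy hxy => ?_⟩
    · have := hf.2.1 x hx
      change f x - 1 ≤ t
      omega
    · have := hrow x hx
      omega
    · exact Nat.sub_le_sub_right (hf.2.2.2 x y hx hy hxy) 1
  · intro f g hf hg hfg
    ext x
    have h : f x - 1 = g x - 1 := congrFun hfg x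
    by_cases hx : InSkewShape μ p x
    · have := hf.2.2.1 x hx (Nat.zero_le _)
      have := hg.2.2.1 x hx (Nat.zero_le _)
      omega
    · rw [hf.1 x hx, hg.1 x hx]
  · intro f hf
    refine ⟨fun x => if InSkewShape μ p x then f x + 1 else 0,
      ⟨fun x hx => by simp [hx], fun x hx => ?_, fun x hx _ => by simp [hx],
        fun x y hx hy hxy => ?_⟩, ?_⟩
    · simpa [hx] using hf.2.1 x hx
    · simpa [hx, hy] using hf.2.2.2 x y hx hy hxy
    · ext x
      by_cases hx : InSkewShape μ p x
      · simp [hx]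
      · simp [hx, hf.1 x hx]

theorem ncard_skewFillings_zero {μ p : ℕ → ℤ} {L : ℕ} (hμ : Antitone μ) (hμ0 : ∀ i, 0 ≤ μ i)
    (hp : Antitone p) (hle : μ ≤ p) (hL : ∀ i, L ≤ i → p i = μ i) :
    ((skewFillings μ p 0 0).ncard : ℚ) = (skewMatrix L μ (rowFlag 0 0) p).det := by
  by_cases hpμ : p = μ
  · subst hpμ
    have hempty : ∀ x, ¬ InSkewShape p p x := fun x hx => by
      have := hx.1
      have := hx.2
      omega
    rw [det_skewMatrix_eq_one hμ (fun i j hij _ => hp hij) fun i _ => Or.inl ⟨by simp [rowFlag], rfl⟩,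
      show skewFillings p p 0 0 = {0} from ?_, Set.ncard_singleton, Nat.cast_one]
    ext f
    constructor
    · intro hf
      ext x
      exact hf.1 x (hempty x)
    · rintro rfl
      exact ⟨fun x _ => rfl, fun x hx => absurd hx (hempty x), fun x hx => absurd hx (hempty x),
        fun x y hx => absurd hx (hempty x)⟩
  · obtain ⟨k, hk⟩ : ∃ k, p k ≠ μ k := by
      by_contra! hcon
      exact hpμ (funext hcon)
    have hkL : k < L := by
      by_contra hcon
      exact hk (hL k (by omega))
    have hlt : μ k < p k := lt_of_le_of_ne (hle k) (Ne.symm hk)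
    rw [det_skewMatrix_eq_zero_of_gt hμ (fun i => Or.inl (by simp [rowFlag])) hkL
        (by simp [rowFlag]) fun i hi => hlt.trans_le (hp hi),
      show skewFillings μ p 0 0 = ∅ from ?_, Set.ncard_empty, Nat.cast_zero]
    rw [Set.eq_empty_iff_forall_notMem]
    intro f hf
    have := hμ0 k
    have hx : InSkewShape μ p (k, (μ k).toNat) := ⟨by simp only; omega, by simp only; omega⟩
    have := hf.2.1 _ hx
    have := hf.2.2.1 _ hx (Nat.zero_le _)
    omega

/-- Induction on the length n of row k. If the row ends in a corner, both sides split off its last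
box. If it is empty or row k+1 ends in the same column, row k cannot contain 0, and the extra
determinant vanishes. -/
theorem ncard_skewFillings_step {μ : ℕ → ℤ} {L : ℕ} (hμ : Antitone μ) (hμ0 : ∀ i, 0 ≤ μ i)
    {t k : ℕ} (hk : k < L)
    (ih : ∀ p : ℕ → ℤ, Antitone p → μ ≤ p → (∀ i, L ≤ i → p i = μ i) →
      ((skewFillings μ p t k).ncard : ℚ) = (skewMatrix L μ (rowFlag t k) p).det)
    (n : ℕ) : ∀ p : ℕ → ℤ, p k = μ k + n → Antitone p → μ ≤ p → (∀ i, L ≤ i → p i = μ i) →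
      ((skewFillings μ p t (k + 1)).ncard : ℚ) =
        (skewMatrix L μ (rowFlag t (k + 1)) p).det := by
  induction n with
  | zero =>
    intro p hpk hp hle hL
    rw [skewFillings_succ_of_forall, ih p hp hle hL, det_skewMatrix_rowFlag_succ μ p t hk,
      left_eq_add]
    -- Row k is empty. Either the shortened row repeats row k+1, or all rows from k on end before
    -- column μ k and there is a zero block.
    · by_cases hdup : k + 1 < L ∧ p (k + 1) = p k
      · exact det_skewMatrix_update_eq_zero μ p t hdup.1 hdup.2
      · refine det_skewMatrix_eq_zero_of_lt hμ hk fun i hi hiL => ?_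
        rcases hi.eq_or_lt with rfl | hlt
        · simp [hpk]
        · have := hp (show k + 1 ≤ i from hlt)
          have hk1 : p (k + 1) ≤ p k := hp k.le_succ
          have hne : p (k + 1) ≠ p k := fun h => hdup ⟨by omega, h⟩
          rw [Function.update_of_ne hlt.ne']
          omega
    · intro f hf x hx hxk
      have := hx.1
      have := hx.2
      rw [hxk] at *
      omega
  | succ n ihn =>
    intro p hpk hp hle hL
    have hpk' : p (k + 1) ≤ p k := hp k.le_succ
    by_cases hcor : p (k + 1) < p k
    · have hqa : Antitone (Function.update p k (p k - 1)) :=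
        antitone_update_sub_one hp hcor
      have h1 : μ k < p k := by omega
      rw [ncard_skewFillings_succ hμ0 hp hL t h1 hcor, det_skewMatrix_rowFlag_succ μ p t hk,
        Nat.cast_add, ih p hp hle hL, ihn _ (by simp [hpk]; ring) hqa]
      · intro i
        simp only [Function.update_apply]
        split_ifs with h
        · subst h; omega
        · exact hle i
      · intro i hi
        rw [Function.update_of_ne (by omega), hL i hi]
    · have hdup : p (k + 1) = p k := by omega
      have hkL : k + 1 < L := by
        by_contra hcon
        have := hL (k + 1) (by omega)
        have : μ (k + 1) ≤ μ k := hμ k.le_succ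
        omega
      rw [skewFillings_succ_of_forall, ih p hp hle hL, det_skewMatrix_rowFlag_succ μ p t hk,
        left_eq_add]
      · exact det_skewMatrix_update_eq_zero μ p t hkL hdup
      · rintro f hf ⟨i, j⟩ hx rfl
        have hx1 : μ i ≤ j := hx.1
        have hx2 : (j : ℤ) < p i := hx.2
        -- The box below lies in the shape and has a positive value, which bounds the value above it
        -- from below.
        have hy : InSkewShape μ p (i + 1, j) := ⟨(hμ i.le_succ).trans hx1, by simpa [hdup]⟩
        exact (hf.2.2.1 _ hy le_rfl).trans (hf.2.2.2 _ _ hx hy (by simp [Prod.le_def]))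

theorem ncard_skewFillings {μ : ℕ → ℤ} {L : ℕ} (hμ : Antitone μ) (hμ0 : ∀ i, 0 ≤ μ i) (t : ℕ) :
    ∀ k, k ≤ L → ∀ p : ℕ → ℤ, Antitone p → μ ≤ p → (∀ i, L ≤ i → p i = μ i) →
      ((skewFillings μ p t k).ncard : ℚ) = (skewMatrix L μ (rowFlag t k) p).det := by
  induction t with
  | zero =>
    intro k
    induction k with
    | zero => exact fun _ p hp hle hL => ncard_skewFillings_zero hμ hμ0 hp hle hL
    | succ k ih =>
      intro hk p hp hle hL
      have : μ k ≤ p k := hle k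
      exact ncard_skewFillings_step hμ hμ0 hk (ih (by omega)) (p k - μ k).toNat p (by omega)
        hp hle hL
  | succ t iht =>
    intro k
    induction k with
    | zero =>
      intro _ p hp hle hL
      rw [ncard_skewFillings_shift hL, iht L le_rfl p hp hle hL]
      congr 1
      ext i j
      simp [skewMatrix, rowFlag]
    | succ k ih =>
      intro hk p hp hle hL
      have : μ k ≤ p k := hle k
      exact ncard_skewFillings_step hμ hμ0 hk (ih (by omega)) (p k - μ k).toNat p (by omega)
        hp hle hL

/-! ### The order polynomial as a determinant -/

/-- The lengths of the rows of a Young diagram as integers. -/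
def YoungDiagram.rowLenInt (lam : YoungDiagram) (i : ℕ) : ℤ := lam.rowLen i

theorem YoungDiagram.antitone_rowLenInt (lam : YoungDiagram) : Antitone lam.rowLenInt :=
  fun _ _ h => Int.ofNat_le.2 (lam.rowLen_anti _ _ h)

theorem YoungDiagram.rowLen_eq_zero_of_le {lam : YoungDiagram} {i : ℕ} (h : lam.colLen 0 ≤ i) :
    lam.rowLen i = 0 := by
  by_contra hne
  have : (i, 0) ∈ lam := YoungDiagram.mem_iff_lt_rowLen.2 (by omega)
  have := YoungDiagram.mem_iff_lt_colLen.1 this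
  omega

theorem YoungDiagram.rowLen_le_of_le {lam mu : YoungDiagram} (h : mu ≤ lam) (i : ℕ) :
    mu.rowLen i ≤ lam.rowLen i := by
  by_contra! hlt
  have : (i, lam.rowLen i) ∈ lam := h (YoungDiagram.mem_iff_lt_rowLen.2 hlt)
  exact lt_irrefl _ (YoungDiagram.mem_iff_lt_rowLen.1 this)

theorem inSkewShape_iff {lam mu : YoungDiagram} (x : ℕ × ℕ) :
    InSkewShape mu.rowLenInt lam.rowLenInt x ↔ x ∈ lam ∧ x ∉ mu := by
  obtain ⟨i, j⟩ := x
  rw [YoungDiagram.mem_iff_lt_rowLen, YoungDiagram.mem_iff_lt_rowLen]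
  simp only [InSkewShape, YoungDiagram.rowLenInt]
  omega

theorem card_orderHom_skewCells (lam mu : YoungDiagram) (t : ℕ) :
    Nat.card (SkewCells lam mu →o Fin t) =
      (skewFillings mu.rowLenInt lam.rowLenInt t 0).ncard := by
  classical
  rw [← Nat.card_coe_set_eq]
  refine Nat.card_congr
    -- Values are shifted by 1, since fillings use 0 only outside the shape when k = 0.
    { toFun := fun f => ⟨fun x => if h : x ∈ lam ∧ x ∉ mu then (f ⟨x, h.1, h.2⟩ : ℕ) + 1 else 0, ?_⟩
      invFun := fun g => ⟨fun x => ⟨g.1 x.box - 1, ?_⟩, ?_⟩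
      left_inv := ?_
      right_inv := ?_ }
  · refine ⟨fun x hx => ?_, fun x hx => ?_, fun x hx _ => ?_, fun x y hx hy hxy => ?_⟩
    · rw [inSkewShape_iff] at hx
      exact dif_neg hx
    · rw [inSkewShape_iff] at hx
      exact (dif_pos hx).trans_le (f _).2
    · rw [inSkewShape_iff] at hx
      refine le_of_le_of_eq ?_ (dif_pos hx).symm
      omega
    · rw [inSkewShape_iff] at hx hy
      refine (dif_pos hy).trans_le (le_of_le_of_eq ?_ (dif_pos hx).symm)
      exact Nat.succ_le_succ (f.monotone (show (⟨y, hy.1, hy.2⟩ : SkewCells lam mu) ≤ ⟨x, hx.1, hx.2⟩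
        from hxy))
  · have hx := (inSkewShape_iff x.box).2 ⟨x.mem, x.notMem⟩
    have := g.2.2.1 _ hx
    have := g.2.2.2.1 _ hx (Nat.zero_le _)
    omega
  · intro x y hxy
    have hx := (inSkewShape_iff x.box).2 ⟨x.mem, x.notMem⟩
    have hy := (inSkewShape_iff y.box).2 ⟨y.mem, y.notMem⟩
    exact Nat.sub_le_sub_right (g.2.2.2.2 _ _ hy hx hxy) 1
  · intro f
    ext x
    change (if h : x.box ∈ lam ∧ x.box ∉ mu then (f ⟨x.box, h.1, h.2⟩ : ℕ) + 1 else 0) - 1 = _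
    rw [dif_pos ⟨x.mem, x.notMem⟩, Nat.add_sub_cancel]
  · intro g
    ext x
    change (if h : x ∈ lam ∧ x ∉ mu then (g.1 x - 1) + 1 else 0) = g.1 x
    split_ifs with h
    · have := g.2.2.2.1 _ ((inSkewShape_iff x).2 h) (Nat.zero_le _)
      omega
    · exact (g.2.1 x fun hx => h ((inSkewShape_iff x).1 hx)).symm

/-- The matrix whose determinant is the order polynomial of a skew shape. -/
noncomputable def skewPolyMatrix (L : ℕ) (μ p : ℕ → ℤ) : Matrix (Fin L) (Fin L) ℚ[X] :=
  Matrix.of fun i j => (risingBinom (p i - (i : ℕ) + (j : ℕ) - μ j)).comp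
    (X + C (((i : ℕ) : ℚ) - ((j : ℕ) : ℚ)))

theorem orderPolynomial_skewCells {lam mu : YoungDiagram} (hsub : mu ≤ lam) {L : ℕ}
    (hL : lam.colLen 0 ≤ L) : orderPolynomial (SkewCells lam mu) =
      (skewPolyMatrix L mu.rowLenInt lam.rowLenInt).det := by
  symm
  refine (existsUnique_orderPolynomial (SkewCells lam mu)).unique (fun t ht => ?_)
    (fun t ht => orderPolynomial_spec _ t ht)
  have hle := YoungDiagram.rowLen_le_of_le hsub
  rw [card_orderHom_skewCells, ncard_skewFillings (L := L) mu.antitone_rowLenInt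
    (fun i => Int.natCast_nonneg _) t 0 (Nat.zero_le _) _ lam.antitone_rowLenInt
    (fun i => Int.ofNat_le.2 (hle i)), ← coe_evalRingHom, RingHom.map_det]
  · congr 1
    ext i j
    simp [skewPolyMatrix, skewMatrix, skewRowVec, rowFlag, eval_comp, add_sub_assoc]
  · intro i hi
    have := hle i
    have := YoungDiagram.rowLen_eq_zero_of_le (hL.trans hi)
    simp only [YoungDiagram.rowLenInt]
    omega

/-! ### The linear coefficient and summation by parts -/

theorem Matrix.derivative_det {L : ℕ} (M : Matrix (Fin L) (Fin L) ℚ[X]) : derivative M.det =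
    ∑ r, (M.updateRow r fun j => derivative (M r j)).det := by
  have hdet : ∀ A : Matrix (Fin L) (Fin L) ℚ[X],
      A.det = ∑ σ : Equiv.Perm (Fin L), (Equiv.Perm.sign σ : ℤ) • ∏ i, A i (σ i) := by
    intro A
    rw [← Matrix.det_transpose, Matrix.det_apply]
    rfl
  simp only [hdet, derivative_sum, derivative_smul, derivative_prod_finset, Finset.smul_sum]
  rw [Finset.sum_comm]
  refine Finset.sum_congr rfl fun r _ => Finset.sum_congr rfl fun σ _ => ?_
  rw [← Finset.mul_prod_erase _ _ (Finset.mem_univ r), Matrix.updateRow_self, mul_comm]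
  congr 2
  refine Finset.prod_congr rfl fun i hi => ?_
  rw [Matrix.updateRow_ne (Finset.ne_of_mem_erase hi)]

/-- The Beta function value `B(m + 1, k + 1)`. -/
def betaFrac (m k : ℕ) : ℚ := (m.factorial * k.factorial : ℚ) / ((m + k + 1).factorial : ℚ)

theorem betaFrac_zero (m : ℕ) : betaFrac m 0 = (m + 1 : ℚ)⁻¹ := by
  have h3 : (m.factorial : ℚ) ≠ 0 := by positivity
  have h4 : (m + 1 : ℚ) ≠ 0 := by positivity
  simp [betaFrac, Nat.factorial_succ]
  field_simp

theorem betaFrac_pos (m k : ℕ) : 0 < betaFrac m k := by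
  unfold betaFrac
  positivity

theorem betaFrac_succ_sub (m k : ℕ) : betaFrac (m + 1) k - betaFrac m k = -betaFrac m (k + 1) := by
  have h1 : ((m + k + 1).factorial : ℚ) ≠ 0 := by positivity
  have h2 : (m + k + 2 : ℚ) ≠ 0 := by positivity
  unfold betaFrac
  rw [show m + 1 + k + 1 = m + k + 1 + 1 by ring, show m + (k + 1) + 1 = m + k + 1 + 1 by ring,
    Nat.factorial_succ (m + k + 1), Nat.factorial_succ m, Nat.factorial_succ k]
  push_cast
  rw [show (m + k + 1 + 1 : ℚ) = m + k + 2 by ring]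
  field_simp
  ring

theorem sum_Ico_mul_sub_succ (β h : ℕ → ℚ) {a b : ℕ} (hab : a ≤ b) :
    ∑ m ∈ Finset.Ico a b, β m * (h m - h (m + 1)) =
      β a * h a - β b * h b + ∑ m ∈ Finset.Ico a b, (β (m + 1) - β m) * h (m + 1) := by
  induction b, hab using Nat.le_induction with
  | base => simp
  | succ b hab ih =>
    rw [Finset.sum_Ico_succ_top hab, Finset.sum_Ico_succ_top hab, ih]
    ring

/-- The derivative of row r at 0 is a harmonic combination of row vectors of the same kind. The
bound N is large enough for all entries at once. -/
theorem coeff_one_det_skewPolyMatrix {L : ℕ} {μ p : ℕ → ℤ} (hμ0 : ∀ i, 0 ≤ μ i) {N : ℕ}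
    (hN : ∀ i, p i + L ≤ N) : (skewPolyMatrix L μ p).det.coeff 1 =
      ∑ r : Fin L, ∑ m ∈ Finset.range N, betaFrac m 0 *
        ((skewMatrix L μ 0 p).updateRow r (skewRowVec L μ (r : ℕ) (p r - (m + 1) - (r : ℕ)))).det := by
  have hc : (skewPolyMatrix L μ p).det.coeff 1 =
      (derivative (skewPolyMatrix L μ p).det).eval 0 := by
    rw [← coeff_zero_eq_eval_zero, coeff_derivative]
    simp
  rw [hc, Matrix.derivative_det, eval_finsetSum]
  refine Finset.sum_congr rfl fun r _ => ?_
  rw [← coe_evalRingHom, RingHom.map_det]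
  have hrow : (evalRingHom (0 : ℚ)).mapMatrix ((skewPolyMatrix L μ p).updateRow r fun j =>
        derivative (skewPolyMatrix L μ p r j)) =
      (skewMatrix L μ 0 p).updateRow r (∑ m ∈ Finset.range N, betaFrac m 0 •
        skewRowVec L μ (r : ℕ) (p r - (m + 1) - (r : ℕ))) := by
    ext i j
    rw [RingHom.mapMatrix_apply, Matrix.map_apply, Matrix.updateRow_apply, Matrix.updateRow_apply]
    split_ifs with hi
    · have := hN r
      have := hμ0 j
      have := j.2
      simp only [skewPolyMatrix, Matrix.of_apply, derivative_comp, coe_evalRingHom]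
      rw [derivative_risingBinom (N := N) (by omega)]
      simp only [Finset.sum_apply, Pi.smul_apply, skewRowVec, smul_eq_mul, betaFrac_zero, eval_mul,
        eval_comp, eval_finsetSum, eval_C, eval_add, eval_X, derivative_add, derivative_X,
        derivative_C, zero_add, add_zero, one_mul]
      refine Finset.sum_congr rfl fun m _ => ?_
      congr 2
      · push_cast; ring
      · congr 1; ring
    · simp [skewPolyMatrix, skewMatrix, skewRowVec, eval_comp]
  rw [hrow]
  have hlin := map_sum ((Matrix.detRowAlternating (R := ℚ) (n := Fin L)).toMultilinearMap.toLinearMap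
    (skewMatrix L μ 0 p) r) (fun m : ℕ => betaFrac m 0 •
        skewRowVec L μ (r : ℕ) (p r - (m + 1) - (r : ℕ))) (Finset.range N)
  refine hlin.trans (Finset.sum_congr rfl fun m _ => ?_)
  exact Matrix.det_updateRow_smul _ _ _ _

/-- The summation by parts which moves the harmonic sum in one row of the matrix into the later
rows. -/
theorem sum_betaFrac_mul_det_updateRow {L : ℕ} {μ p : ℕ → ℤ} (hμ0 : ∀ i, 0 ≤ μ i)
    (hp : Antitone p) {N : ℕ} (hN : ∀ i, p i + L ≤ N) (hp0 : ∀ i, 0 ≤ p i) (r : Fin L) (k : ℕ)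
    (hk : (r : ℕ) + (k + 1) < L) :
    ∑ m ∈ Finset.Ico (p r - p (r + k)).toNat N, betaFrac m k * ((skewMatrix L μ 0 p).updateRow r
      (skewRowVec L μ ((r : ℕ) + k) (p r - (m + 1) - ((r : ℕ) + k)))).det =
    ∑ m ∈ Finset.Ico (p r - p (r + k)).toNat (p r - p (r + (k + 1))).toNat, betaFrac m k *
      ((skewMatrix L μ 0 p).updateRow r
        (skewRowVec L μ ((r : ℕ) + k) (p r - (m + 1) - ((r : ℕ) + k)))).det -
    ∑ m ∈ Finset.Ico (p r - p (r + (k + 1))).toNat N, betaFrac m (k + 1) *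
      ((skewMatrix L μ 0 p).updateRow r (skewRowVec L μ ((r : ℕ) + (k + 1 : ℕ))
        (p r - (m + 1) - ((r : ℕ) + (k + 1 : ℕ))))).det := by
  have h1 : p (r + (k + 1)) ≤ p (r + k) := hp (by omega)
  have h2 : p (r + (k + 1)) ≤ p r := hp (by omega)
  have h3 := hN r
  have h4 := hp0 (r + (k + 1))
  have hbN : (p r - p (r + (k + 1))).toNat ≤ N := by omega
  rw [← Finset.sum_Ico_consecutive _ (show (p r - p (r + k)).toNat ≤ _ by omega) hbN]
  refine Eq.trans ?_ (sub_eq_add_neg _ _).symm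
  congr 1
  set h : ℕ → ℚ := fun m => ((skewMatrix L μ 0 p).updateRow r (skewRowVec L μ
    ((r : ℕ) + (k + 1 : ℕ)) (p r - m - ((r : ℕ) + (k + 1 : ℕ))))).det with hh
  -- Pascal's rule, read as a difference: v(c-1, q) = v(c, q) - v(c, q-1) with c = r+k+1.
  have hstep : ∀ m : ℕ, ((skewMatrix L μ 0 p).updateRow r
      (skewRowVec L μ ((r : ℕ) + k) (p r - (m + 1) - ((r : ℕ) + k)))).det = h m - h (m + 1) := by
    intro m
    have hw := skewRowVec_pascal (L := L) μ ((r : ℕ) + (k + 1 : ℕ))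
      (p r - m - ((r : ℕ) + (k + 1 : ℕ)))
    rw [show ((r : ℕ) : ℤ) + (k + 1 : ℕ) - 1 = (r : ℕ) + k by push_cast; ring,
      show p r - m - (((r : ℕ) : ℤ) + (k + 1 : ℕ)) - 1 =
        p r - (m + 1 : ℕ) - ((r : ℕ) + (k + 1 : ℕ)) by push_cast; ring] at hw
    simp only [hh]
    rw [hw, Matrix.det_updateRow_add, add_sub_cancel_left,
      show p r - (m + 1) - (((r : ℕ) : ℤ) + k) = p r - m - ((r : ℕ) + (k + 1 : ℕ)) by
        push_cast; ring]
  -- The split point of the range is chosen so that the replaced row coincides here with row r+k+1.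
  have ha : h (p r - p (r + (k + 1))).toNat = 0 := by
    refine Matrix.det_zero_of_row_eq (i := r) (j := ⟨r + (k + 1), hk⟩)
      (by simp [Fin.ext_iff]) ?_
    rw [Matrix.updateRow_self, Matrix.updateRow_ne (by simp [Fin.ext_iff])]
    ext j
    have : p r - ((p r - p (r + (k + 1))).toNat : ℤ) = p (r + (k + 1)) := by omega
    simp only [skewMatrix, Matrix.of_apply, this]
    simp
  have hb : h N = 0 := by
    refine Matrix.det_eq_zero_of_row_eq_zero r fun j => ?_
    rw [Matrix.updateRow_self]
    have := hμ0 j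
    exact skewRowVec_apply_eq_zero (by omega)
  simp only [hstep]
  rw [sum_Ico_mul_sub_succ (fun m => betaFrac m k) h hbN, ha, hb, mul_zero, mul_zero, sub_zero,
    zero_add, ← Finset.sum_neg_distrib]
  refine Finset.sum_congr rfl fun m _ => ?_
  simp only [betaFrac_succ_sub, hh, Nat.cast_succ]
  ring

theorem sum_betaFrac_zero_mul_det {L : ℕ} {μ p : ℕ → ℤ} (hμ0 : ∀ i, 0 ≤ μ i)
    (hp : Antitone p) {N : ℕ} (hN : ∀ i, p i + L ≤ N) (hp0 : ∀ i, 0 ≤ p i) (r : Fin L) (K : ℕ)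
    (hK : (r : ℕ) + K < L) :
    ∑ m ∈ Finset.range N, betaFrac m 0 * ((skewMatrix L μ 0 p).updateRow r
      (skewRowVec L μ (r : ℕ) (p r - (m + 1) - (r : ℕ)))).det =
    ∑ k ∈ Finset.range K, (-1) ^ k *
      ∑ m ∈ Finset.Ico (p r - p (r + k)).toNat (p r - p (r + (k + 1))).toNat, betaFrac m k *
        ((skewMatrix L μ 0 p).updateRow r
          (skewRowVec L μ ((r : ℕ) + k) (p r - (m + 1) - ((r : ℕ) + k)))).det +
    (-1) ^ K * ∑ m ∈ Finset.Ico (p r - p (r + K)).toNat N, betaFrac m K *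
      ((skewMatrix L μ 0 p).updateRow r
        (skewRowVec L μ ((r : ℕ) + K) (p r - (m + 1) - ((r : ℕ) + K)))).det := by
  induction K with
  | zero => simp
  | succ K ih =>
    rw [ih (by omega), sum_betaFrac_mul_det_updateRow hμ0 hp hN hp0 r K hK,
      Finset.sum_range_succ]
    rw [pow_succ]
    ring

/-! ### Moving the replaced row into place -/

/-- The new row y travels from position r to r+k by k adjacent transpositions, while the rows it
passes move up by one. -/
theorem det_shift_rows {L : ℕ} (x : ℕ → Fin L → ℚ) (r : Fin L) (y : Fin L → ℚ) (k : ℕ)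
    (hk : (r : ℕ) + k < L) :
    (Matrix.of fun i : Fin L => if (i : ℕ) < r then x i else if (i : ℕ) < r + k then x (i + 1)
      else if (i : ℕ) = r + k then y else x i).det =
    (-1) ^ k * ((Matrix.of fun i : Fin L => x i).updateRow r y).det := by
  induction k with
  | zero =>
    rw [pow_zero, one_mul]
    congr 1
    ext i j
    rw [Matrix.updateRow_apply]
    by_cases h : i = r
    · subst h
      simp
    · have h' : (i : ℕ) ≠ r := fun h' => h (Fin.ext h')
      simp only [Matrix.of_apply, add_zero, h, h', if_false]
      split_ifs <;> rfl
  | succ k ih =>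
    rw [pow_succ, mul_right_comm, ← ih (by omega), mul_neg_one]
    set a : Fin L := ⟨r + k, by omega⟩ with ha
    set b : Fin L := ⟨r + (k + 1), hk⟩ with hb
    have hab : a ≠ b := by simp [ha, hb]
    have hp := Matrix.det_permute (R := ℚ) (Equiv.swap a b) (Matrix.of fun i : Fin L =>
      if (i : ℕ) < r then x i else if (i : ℕ) < r + k then x (i + 1)
      else if (i : ℕ) = r + k then y else x i)
    rw [Equiv.Perm.sign_swap hab] at hp
    push_cast at hp
    rw [neg_one_mul] at hp
    rw [← hp]
    congr 1
    ext i j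
    rw [Matrix.submatrix_apply, id, Matrix.of_apply, Matrix.of_apply]
    rcases eq_or_ne i a with rfl | hia
    · rw [Equiv.swap_apply_left]
      simp [ha, hb, add_assoc]
    · rcases eq_or_ne i b with rfl | hib
      · rw [Equiv.swap_apply_right]
        simp [ha, hb]
      · rw [Equiv.swap_apply_of_ne_of_ne hia hib]
        have h1 : (i : ℕ) ≠ r + k := fun h => hia (Fin.ext h)
        have h2 : (i : ℕ) ≠ r + (k + 1) := fun h => hib (Fin.ext h)
        have h3 : (i : ℕ) < r + (k + 1) ↔ (i : ℕ) < r + k := by omega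
        simp only [h1, h2, h3, if_false]

open Classical in
-- With at most one value per row there is at most one filling, and a row with no value must be
-- empty.
theorem det_skewMatrix_eq_ite {L : ℕ} {μ c p : ℕ → ℤ} (hμ : Antitone μ)
    (hp : ∀ i j, i ≤ j → j < L → p j ≤ p i) (hc : ∀ i, c i = 0 ∨ c i = 1) :
    (skewMatrix L μ c p).det =
      if ∀ i, i < L → (c i = 0 ∧ p i = μ i) ∨ (c i = 1 ∧ μ i ≤ p i) then 1 else 0 := by
  split_ifs with h
  · exact det_skewMatrix_eq_one hμ hp h
  · push Not at h
    obtain ⟨k, hk, h0, h1⟩ := h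
    rcases lt_or_ge (p k) (μ k) with hlt | hge
    · exact det_skewMatrix_eq_zero_of_lt hμ hk fun i hi hiL => (hp k i hi hiL).trans_lt hlt
    · have hck : c k = 0 := (hc k).resolve_right fun h => by
        have := h1 h
        omega
      have := h0 hck
      exact det_skewMatrix_eq_zero_of_gt hμ hc hk hck fun i hi =>
        (show μ k < p k by omega).trans_le (hp i k hi hk)

/-- The rows from `r` to `r + k` of `p / μ` form a connected skew shape whose last row begins in
column `q`, and all other rows are empty. -/
def IsSkewBand (L : ℕ) (μ p : ℕ → ℤ) (r k : ℕ) (q : ℤ) : Prop :=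
  q = μ (r + k) ∧ (∀ i, r ≤ i → i < r + k → μ i < p (i + 1)) ∧
    ∀ i, i < L → i < r ∨ r + k < i → p i = μ i

open Classical in
theorem neg_one_pow_mul_det_updateRow {L : ℕ} {μ p : ℕ → ℤ} (hμ : Antitone μ) (hp : Antitone p)
    (r : Fin L) (k : ℕ) (hk : (r : ℕ) + k < L) {q : ℤ} (hq : q < p (r + k))
    (hq' : p (r + (k + 1)) ≤ q) :
    (-1) ^ k * ((skewMatrix L μ 0 p).updateRow r
      (skewRowVec L μ ((r : ℕ) + k) (q - ((r : ℕ) + k)))).det =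
      if IsSkewBand L μ p r k q then 1 else 0 := by
  set c : ℕ → ℤ := fun i => if (r : ℕ) ≤ i ∧ i < r + k then 1 else 0 with hcdef
  -- A row with bound 0 and length p (i+1) at position i+1 is, at position i, a row with bound 1 and
  -- length p (i+1) - 1; the vector itself does not change.
  set s : ℕ → ℤ := fun i => if i < r then p i else if i < r + k then p (i + 1) - 1
      else if i = r + k then q else p i with hsdef
  have hM : (skewMatrix L μ 0 p).updateRow r
      (skewRowVec L μ ((r : ℕ) + k) (q - ((r : ℕ) + k))) =
      (Matrix.of fun i : Fin L => (fun i : ℕ => skewRowVec L μ i (p i - i)) i).updateRow r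
      (skewRowVec L μ ((r : ℕ) + k) (q - ((r : ℕ) + k))) := by
    congr 1
    ext i j
    simp [skewMatrix]
  have hS : (Matrix.of fun i : Fin L => if (i : ℕ) < r then
      (fun i : ℕ => skewRowVec L μ i (p i - i)) i else if (i : ℕ) < r + k then
      (fun i : ℕ => skewRowVec L μ i (p i - i)) (i + 1)
      else if (i : ℕ) = r + k then (skewRowVec L μ ((r : ℕ) + k) (q - ((r : ℕ) + k))) else
      (fun i : ℕ => skewRowVec L μ i (p i - i)) i) = skewMatrix L μ c s := by
    ext i j
    simp only [skewMatrix, Matrix.of_apply, hcdef, hsdef]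
    split_ifs <;> first | omega | skip
    · simp
    · congr 1 <;> (push_cast; ring)
    · congr 1 <;> omega
    · simp
  rw [hM, ← det_shift_rows (fun i : ℕ => skewRowVec L μ i (p i - i)) r _ k hk, hS, det_skewMatrix_eq_ite hμ]
  · refine if_congr ?_ rfl rfl
    constructor
    · intro h
      refine ⟨?_, fun i h1 h2 => ?_, fun i hi h1 => ?_⟩
      · have := h (r + k) hk
        simp [hcdef, hsdef] at this
        exact this
      · have := h i (by omega)
        simp only [hcdef, hsdef, h1, h2, and_self, if_true, if_neg (not_lt.2 h1)] at this
        omega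
      · have := h i hi
        have hc0 : ¬ ((r : ℕ) ≤ i ∧ i < r + k) := by omega
        simp only [hcdef, hsdef, if_neg hc0] at this
        split_ifs at this <;> omega
    · rintro ⟨h1, h2, h3⟩ i hi
      by_cases h4 : (r : ℕ) ≤ i ∧ i < r + k
      · have := h2 i h4.1 h4.2
        refine Or.inr ⟨if_pos h4, ?_⟩
        simp only [hsdef, if_neg (not_lt.2 h4.1), if_pos h4.2]
        omega
      · refine Or.inl ⟨if_neg h4, ?_⟩
        by_cases h5 : i = r + k
        · simp [hsdef, h5, h1]
        · have := h3 i hi (by omega)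
          simp only [hsdef]
          split_ifs <;> first | exact this | omega
  · intro i j hij hj
    have e1 := hp hij
    have e2 : i ≤ r + k → p (r + k) ≤ p i := fun h => hp h
    have e3 : i < r + k → p (r + k) ≤ p (i + 1) := fun h => hp h
    have e4 : r + k < j → p j ≤ p (r + (k + 1)) := fun h => hp (by omega)
    have e5 : p (j + 1) ≤ p (i + 1) := hp (by omega)
    have e6 : p (j + 1) ≤ p i := hp (by omega)
    simp only [hsdef]
    split_ifs <;> omega
  · intro i
    simp only [hcdef]
    split_ifs <;> simp

open Classical in
-- The signs of the summation by parts and of the row moves cancel. The additional empty row n makes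
-- the remaining tail vanish.
theorem coeff_one_det_eq_sum {n : ℕ} {μ p : ℕ → ℤ} (hμ : Antitone μ) (hp : Antitone p)
    (hμ0 : ∀ i, 0 ≤ μ i) (hp0 : ∀ i, 0 ≤ p i) (hn : p n = 0) :
    (skewPolyMatrix (n + 1) μ p).det.coeff 1 =
      ∑ r : Fin (n + 1), ∑ k ∈ Finset.range (n - r),
        ∑ m ∈ Finset.Ico (p r - p (r + k)).toNat (p r - p (r + (k + 1))).toNat,
          if IsSkewBand (n + 1) μ p r k (p r - (m + 1)) then betaFrac m k else 0 := by
  have hN : ∀ i, p i + (n + 1 : ℕ) ≤ ((p 0 + (n + 1 : ℕ)).toNat : ℕ) := fun i => by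
    have := hp (Nat.zero_le i)
    omega
  rw [coeff_one_det_skewPolyMatrix hμ0 hN]
  refine Finset.sum_congr rfl fun r _ => ?_
  have hr := r.2
  rw [sum_betaFrac_zero_mul_det hμ0 hp hN hp0 r (n - r) (by omega), add_eq_left.2]
  · refine Finset.sum_congr rfl fun k hk => ?_
    rw [Finset.mul_sum]
    refine Finset.sum_congr rfl fun m hm => ?_
    rw [Finset.mem_range] at hk
    rw [Finset.mem_Ico] at hm
    have h1 : p (r + (k + 1)) ≤ p r := hp (by omega)
    have h2 : p (r + k) ≤ p r := hp (by omega)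
    rw [mul_left_comm, neg_one_pow_mul_det_updateRow hμ hp r k (by omega) (by omega) (by omega),
      mul_ite, mul_one, mul_zero]
  -- In the tail m ≥ p r, so the replaced row has negative length and is zero.
  · rw [Finset.sum_eq_zero, mul_zero]
    intro m hm
    rw [Finset.mem_Ico, show (r : ℕ) + (n - r) = n by omega, hn] at hm
    rw [Matrix.det_eq_zero_of_row_eq_zero r, mul_zero]
    intro j
    rw [Matrix.updateRow_self]
    have := hμ0 j
    exact skewRowVec_apply_eq_zero (by omega)

/-! ### Connectedness in terms of row lengths -/

theorem mem_skewCells_iff {lam mu : YoungDiagram} (i j : ℕ) :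
    ((i, j) ∈ lam ∧ (i, j) ∉ mu) ↔ mu.rowLen i ≤ j ∧ j < lam.rowLen i := by
  rw [YoungDiagram.mem_iff_lt_rowLen, YoungDiagram.mem_iff_lt_rowLen, not_lt, and_comm]

/-- From any box one walks right to the end of its row, then up, which the overlap of consecutive
rows allows, and so on to the last box of row r. -/
theorem skewConnected_of_forall_lt {lam mu : YoungDiagram} {r s : ℕ}
    (hr : IsLeast (skewRows lam mu) r) (hs : IsGreatest (skewRows lam mu) s)
    (h : ∀ i, r ≤ i → i < s → mu.rowLen i < lam.rowLen (i + 1)) : SkewConnected lam mu := by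
  have hr0 : mu.rowLen r < lam.rowLen r := hr.1
  have hcell := (mem_skewCells_iff (lam := lam) (mu := mu) r (lam.rowLen r - 1)).2 (by omega)
  set c0 : SkewCells lam mu := ⟨(r, lam.rowLen r - 1), hcell.1, hcell.2⟩ with hc0
  -- This measure drops with each step to the right or upwards.
  have key : ∀ N : ℕ, ∀ c : SkewCells lam mu, c.box.1 + (lam.rowLen 0 - c.box.2) ≤ N →
      (SimpleGraph.hasse (SkewCells lam mu)).Reachable c c0 := by
    intro N
    induction N with
    | zero =>
      rintro ⟨⟨i, j⟩, hc, hc'⟩ hN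
      have h1 := (mem_skewCells_iff i j).1 ⟨hc, hc'⟩
      have h2 := lam.rowLen_anti 0 i (Nat.zero_le _)
      simp only at hN
      omega
    | succ N ih =>
      rintro ⟨⟨i, j⟩, hc, hc'⟩ hN
      have h1 := (mem_skewCells_iff i j).1 ⟨hc, hc'⟩
      have h2 := lam.rowLen_anti 0 i (Nat.zero_le _)
      have hri : r ≤ i := hr.2 (show mu.rowLen i < lam.rowLen i by omega)
      have his : i ≤ s := hs.2 (show mu.rowLen i < lam.rowLen i by omega)
      simp only at hN
      by_cases hj : j + 1 < lam.rowLen i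
      · have hd := (mem_skewCells_iff (lam := lam) (mu := mu) i (j + 1)).2 (by omega)
        refine SimpleGraph.Reachable.trans (SimpleGraph.Adj.reachable ?_)
          (ih ⟨(i, j + 1), hd.1, hd.2⟩ (by simp only; omega))
        rw [SimpleGraph.hasse_adj]
        exact Or.inr ((SkewCells.covBy_iff _ _).2 (Or.inr rfl))
      · rcases hri.eq_or_lt with rfl | hlt
        · have : j = lam.rowLen r - 1 := by omega
          subst this
          exact SimpleGraph.Reachable.refl _
        · obtain ⟨a, rfl⟩ : ∃ a, i = a + 1 := ⟨i - 1, by omega⟩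
          have h3 := h a (by omega) (by omega)
          have h4 := lam.rowLen_anti a (a + 1) (by omega)
          have hd := (mem_skewCells_iff (lam := lam) (mu := mu) a j).2 (by omega)
          refine SimpleGraph.Reachable.trans (SimpleGraph.Adj.reachable ?_)
            (ih ⟨(a, j), hd.1, hd.2⟩ (by simp only; omega))
          rw [SimpleGraph.hasse_adj]
          exact Or.inl ((SkewCells.covBy_iff _ _).2 (Or.inl rfl))
  have : Nonempty (SkewCells lam mu) := ⟨c0⟩
  exact ⟨fun c d => (key _ c le_rfl).trans (key _ d le_rfl).symm⟩

/-- Without the overlap no edge joins row i to row i+1, so a path cannot leave the rows up to i. -/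
theorem SkewConnected.rowLen_lt {lam mu : YoungDiagram} (hconn : SkewConnected lam mu) {r s : ℕ}
    (hr : r ∈ skewRows lam mu) (hs : s ∈ skewRows lam mu) {i : ℕ} (hri : r ≤ i) (his : i < s) :
    mu.rowLen i < lam.rowLen (i + 1) := by
  by_contra! hle
  have hr0 : mu.rowLen r < lam.rowLen r := hr
  have hs0 : mu.rowLen s < lam.rowLen s := hs
  have hc := (mem_skewCells_iff (lam := lam) (mu := mu) r (mu.rowLen r)).2 (by omega)
  have hd := (mem_skewCells_iff (lam := lam) (mu := mu) s (mu.rowLen s)).2 (by omega)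
  have hadj : ∀ c d : SkewCells lam mu, (SimpleGraph.hasse (SkewCells lam mu)).Adj c d →
      c.box.1 ≤ i → d.box.1 ≤ i := by
    rintro ⟨⟨a, b⟩, h1, h1'⟩ ⟨⟨a', b'⟩, h2, h2'⟩ h
    have h3 := (mem_skewCells_iff a b).1 ⟨h1, h1'⟩
    have h4 := (mem_skewCells_iff a' b').1 ⟨h2, h2'⟩
    rw [SimpleGraph.hasse_adj, SkewCells.covBy_iff, SkewCells.covBy_iff] at h
    simp only [Prod.mk.injEq] at h ⊢
    intro hai
    by_contra! hcon
    have ha : a = i := by omega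
    have ha' : a' = i + 1 := by omega
    subst ha ha'
    omega
  obtain ⟨w⟩ := hconn.preconnected ⟨_, hc.1, hc.2⟩ ⟨_, hd.1, hd.2⟩
  have key : ∀ c d : SkewCells lam mu, (SimpleGraph.hasse (SkewCells lam mu)).Walk c d →
      c.box.1 ≤ i → d.box.1 ≤ i := by
    intro c d w
    induction w with
    | nil => exact id
    | cons h _ ih => exact fun hc => ih (hadj _ _ h hc)
  exact absurd (key _ _ w hri) (by simpa using his)

/-- A band determines r and k from the shape, so at most one pair contributes to the sum. -/
theorem IsSkewBand.isLeast_isGreatest {lam mu : YoungDiagram} {L r k : ℕ} {q : ℤ}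
    (hL : lam.colLen 0 ≤ L)
    (h : IsSkewBand L mu.rowLenInt lam.rowLenInt r k q) (hq : q < lam.rowLen (r + k)) :
    IsLeast (skewRows lam mu) r ∧ IsGreatest (skewRows lam mu) (r + k) := by
  obtain ⟨h1, h2, h3⟩ := h
  simp only [YoungDiagram.rowLenInt, Nat.cast_lt, Nat.cast_inj] at h1 h2 h3
  have hout : ∀ i ∈ skewRows lam mu, r ≤ i ∧ i ≤ r + k := by
    intro i hi
    have hi' : mu.rowLen i < lam.rowLen i := hi
    by_contra hcon
    rcases lt_or_ge i L with hiL | hiL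
    · have := h3 i hiL (by omega)
      omega
    · have := YoungDiagram.rowLen_eq_zero_of_le (hL.trans hiL)
      omega
  refine ⟨⟨?_, fun i hi => (hout i hi).1⟩, ⟨?_, fun i hi => (hout i hi).2⟩⟩
  · change mu.rowLen r < lam.rowLen r
    rcases Nat.eq_zero_or_pos k with rfl | hk
    · rw [add_zero] at *
      omega
    · exact (h2 r le_rfl (by omega)).trans_le (lam.rowLen_anti _ _ (by omega))
  · change mu.rowLen (r + k) < lam.rowLen (r + k)
    omega

theorem IsSkewBand.skewConnected {lam mu : YoungDiagram} {L r k : ℕ} {q : ℤ}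
    (hL : lam.colLen 0 ≤ L)
    (h : IsSkewBand L mu.rowLenInt lam.rowLenInt r k q) (hq : q < lam.rowLen (r + k)) :
    SkewConnected lam mu := by
  obtain ⟨hr, hs⟩ := h.isLeast_isGreatest hL hq
  refine skewConnected_of_forall_lt hr hs fun i h1 h2 => ?_
  simpa [YoungDiagram.rowLenInt] using h.2.1 i h1 h2

/-! ### Evaluation of the sum and the theorem -/

open Classical in
theorem coeff_one_orderPolynomial_skewCells {lam mu : YoungDiagram} (hsub : mu ≤ lam) :
    (orderPolynomial (SkewCells lam mu)).coeff 1 =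
      ∑ r : Fin (lam.colLen 0 + 1), ∑ k ∈ Finset.range (lam.colLen 0 - r),
        ∑ m ∈ Finset.Ico (lam.rowLenInt r - lam.rowLenInt (r + k)).toNat
            (lam.rowLenInt r - lam.rowLenInt (r + (k + 1))).toNat,
          if IsSkewBand (lam.colLen 0 + 1) mu.rowLenInt lam.rowLenInt r k
            (lam.rowLenInt r - (m + 1)) then betaFrac m k else 0 := by
  rw [orderPolynomial_skewCells hsub (Nat.le_succ _)]
  refine coeff_one_det_eq_sum mu.antitone_rowLenInt lam.antitone_rowLenInt
    (fun _ => Int.natCast_nonneg _) (fun _ => Int.natCast_nonneg _) ?_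
  rw [YoungDiagram.rowLenInt, YoungDiagram.rowLen_eq_zero_of_le le_rfl, Nat.cast_zero]

theorem coeff_one_eq_zero_of_not_skewConnected {lam mu : YoungDiagram} (hsub : mu ≤ lam)
    (h : ¬ SkewConnected lam mu) : (orderPolynomial (SkewCells lam mu)).coeff 1 = 0 := by
  rw [coeff_one_orderPolynomial_skewCells hsub]
  refine Finset.sum_eq_zero fun r _ => Finset.sum_eq_zero fun k _ => Finset.sum_eq_zero fun m hm =>
    if_neg fun hb => h (hb.skewConnected (Nat.le_succ _) ?_)
  rw [Finset.mem_Ico] at hm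
  simp only [YoungDiagram.rowLenInt] at *
  omega

theorem coeff_one_of_skewConnected {lam mu : YoungDiagram} (hsub : mu ≤ lam)
    (hconn : SkewConnected lam mu) {r s : ℕ} (hr : IsLeast (skewRows lam mu) r)
    (hs : IsGreatest (skewRows lam mu) s) : (orderPolynomial (SkewCells lam mu)).coeff 1 =
      betaFrac (lam.rowLen r - mu.rowLen s - 1) (s - r) := by
  have hrs : r ≤ s := hr.2 hs.1
  have hs0 : mu.rowLen s < lam.rowLen s := hs.1
  have hsn : s < lam.colLen 0 := by
    by_contra! hcon
    have := YoungDiagram.rowLen_eq_zero_of_le hcon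
    omega
  have hle := YoungDiagram.rowLen_le_of_le hsub
  have hrs' := lam.rowLen_anti r s hrs
  -- Row s+1 is empty, so μ s lies in the range of lengths available for k = s - r.
  have hlast : lam.rowLen (s + 1) ≤ mu.rowLen s := by
    have h1 : ¬ mu.rowLen (s + 1) < lam.rowLen (s + 1) := fun h => by
      have := hs.2 h
      omega
    have := mu.rowLen_anti s (s + 1) s.le_succ
    omega
  rw [coeff_one_orderPolynomial_skewCells hsub,
    Finset.sum_eq_single (⟨r, by omega⟩ : Fin (lam.colLen 0 + 1)),
    Finset.sum_eq_single (s - r), Finset.sum_eq_single (lam.rowLen r - mu.rowLen s - 1), if_pos]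
  · refine ⟨?_, fun i h1 h2 => ?_, fun i _ hi => ?_⟩
    · simp only [YoungDiagram.rowLenInt, show r + (s - r) = s by omega]
      omega
    · exact Int.ofNat_lt.2 (hconn.rowLen_lt hr.1 hs.1 h1 (by simp only at h2; omega))
    · have h1 : ¬ mu.rowLen i < lam.rowLen i := fun h => by
        have := hs.2 h
        have := hr.2 h
        simp only at hi
        omega
      have := hle i
      simp only [YoungDiagram.rowLenInt]
      omega
  · intro m hm hne
    refine if_neg fun hb => hne ?_
    have := hb.1
    simp only [YoungDiagram.rowLenInt, show r + (s - r) = s by omega] at this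
    omega
  · intro hm
    refine absurd (Finset.mem_Ico.2 ?_) hm
    simp only [YoungDiagram.rowLenInt, show r + (s - r) = s by omega,
      show r + (s - r + 1) = s + 1 by omega]
    omega
  · intro k _ hne
    refine Finset.sum_eq_zero fun m hm => if_neg fun hb => hne ?_
    rw [Finset.mem_Ico] at hm
    have := (hb.isLeast_isGreatest (Nat.le_succ _)
      (by simp only [YoungDiagram.rowLenInt] at *; omega)).2.unique hs
    simp only at this
    omega
  · intro hk
    refine absurd (Finset.mem_range.2 ?_) hk
    simp only
    omega
  · intro a _ hne
    refine Finset.sum_eq_zero fun k _ => Finset.sum_eq_zero fun m hm => if_neg fun hb => hne ?_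
    rw [Finset.mem_Ico] at hm
    exact Fin.ext ((hb.isLeast_isGreatest (Nat.le_succ _)
      (by simp only [YoungDiagram.rowLenInt] at *; omega)).1.unique hr)
  · exact fun h => absurd (Finset.mem_univ _) h

theorem SkewConnected.exists_isLeast_isGreatest {lam mu : YoungDiagram}
    (hconn : SkewConnected lam mu) :
    ∃ r s, IsLeast (skewRows lam mu) r ∧ IsGreatest (skewRows lam mu) s := by
  have hne : (skewRows lam mu).Nonempty := by
    obtain ⟨⟨⟨i, j⟩, h, h'⟩⟩ := hconn.nonempty
    have := (mem_skewCells_iff i j).1 ⟨h, h'⟩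
    exact ⟨i, show mu.rowLen i < lam.rowLen i by omega⟩
  have hbdd : BddAbove (skewRows lam mu) := by
    refine ⟨lam.colLen 0, fun i hi => ?_⟩
    have hi' : mu.rowLen i < lam.rowLen i := hi
    by_contra! hcon
    have := YoungDiagram.rowLen_eq_zero_of_le hcon.le
    omega
  exact ⟨_, _, ⟨Nat.sInf_mem hne, fun _ h => Nat.sInf_le h⟩,
    ⟨Nat.sSup_mem hne hbdd, fun _ h => le_csSup hbdd h⟩⟩

/-- The natural subtractions in the formula do not truncate: mu.rowLen s < lam.rowLen s ≤ lam.rowLen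
r, and l ≥ 1 because r ≤ s. -/
theorem proposition4p1 (lam mu : YoungDiagram) (hsub : mu ≤ lam) :
    (¬ SkewConnected lam mu → (orderPolynomial (SkewCells lam mu)).coeff 1 = 0) ∧
    (SkewConnected lam mu → 0 < (orderPolynomial (SkewCells lam mu)).coeff 1) ∧
    (∀ r s l : ℕ, IsLeast (skewRows lam mu) r → IsGreatest (skewRows lam mu) s → s + 1 = r + l →
      (¬ SkewConnected lam mu ↔
        ∃ i, r ≤ i ∧ i ≤ s ∧
          (lam.rowLen i = mu.rowLen i ∨ (r < i ∧ lam.rowLen i ≤ mu.rowLen (i - 1)))) ∧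
      (SkewConnected lam mu →
        (orderPolynomial (SkewCells lam mu)).coeff 1 =
          ((lam.rowLen r - mu.rowLen s - 1).factorial * (l - 1).factorial : ℚ) /
            ((lam.rowLen r - mu.rowLen s - 1 + l).factorial : ℚ))) := by
  refine ⟨coeff_one_eq_zero_of_not_skewConnected hsub, fun hconn => ?_,
    fun r s l hr hs hl => ⟨⟨fun h => ?_, ?_⟩, fun hconn => ?_⟩⟩
  · obtain ⟨r, s, hr, hs⟩ := hconn.exists_isLeast_isGreatest
    rw [coeff_one_of_skewConnected hsub hconn hr hs]
    exact betaFrac_pos _ _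
  · by_contra! hcon
    refine h (skewConnected_of_forall_lt hr hs fun i h1 h2 => ?_)
    exact (hcon (i + 1) (by omega) h2).2 (by omega)
  · rintro ⟨i, h1, h2, h3⟩ hconn
    have hr0 : mu.rowLen r < lam.rowLen r := hr.1
    -- Row r is nonempty, so either alternative forces i > r; an empty row i then also gives
    -- lam.rowLen i ≤ mu.rowLen (i - 1).
    have hri : r < i := by
      rcases h1.eq_or_lt with rfl | h
      · omega
      · exact h
    have h4 := hconn.rowLen_lt hr.1 hs.1 (show r ≤ i - 1 by omega) (by omega)
    rw [show i - 1 + 1 = i by omega] at h4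
    have := mu.rowLen_anti (i - 1) i (by omega)
    omega
  · have hrs : r ≤ s := hr.2 hs.1
    rw [coeff_one_of_skewConnected hsub hconn hr hs, betaFrac, show s - r = l - 1 by omega,
      show lam.rowLen r - mu.rowLen s - 1 + (l - 1) + 1 = lam.rowLen r - mu.rowLen s - 1 + l by
        omega]
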